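/- Let $\mathbb Z_2$ be the ring of $2$-adic integers with absolute value $|\cdot|_2$, and let $f\colon\mathbb Z_2\to\mathbb Z_2$ be a T-function, i.e. for every $j\ge 0$ the $j$-th binary digit of $f(x)$ is a Boolean function of the binary digits of $x$ with indices $0,\dots,j$ (equivalently, $|f(x)-f(y)|_2\le|x-y|_2$ for all $x,y\in\mathbb Z_2$). Let $f$ be represented by its van der Put series $$f(x)=\sum_{m=0}^{\infty}B_m\,\chi(m,x)\qquad(x\in\mathbb Z_2),\qquad B_m\in\mathbb Z_2,$$ where $\chi(m,x)=1$ if $|x-m|_2\le 2^{-(\lfloor\log_2 m\rfloor+1)}$ and $\chi(m,x)=0$ otherwise, with the convention $\lfloor\log_2 0\rfloor=0$. Then $f$ is ergodic with respect to the normalized Haar measure $\mu$ on $\mathbb Z_2$ (i.e. $f$ preserves $\mu$, and every measurable $S$ with $f^{-1}(S)=S$ has $\mu(S)\in\{0,1\}$) if and only if the following conditions are satisfied simultaneously: 1. $B_0\equiv 1\pmod 2$; 2. $B_0+B_1\equiv 3\pmod 4$; 3. $|B_m|_2=2^{-(n-1)}$ for all $n\ge 2$ and all $m$ with $2^{n-1}\le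 m<2^n-1$; 4. $\left|\sum_{m=2^{n-1}}^{2^n-1}(B_m-2^{n-1})\right|_2\le 2^{-(n+1)}$ for all $n\ge 2$. -/

import Mathlib

namespace VanDerPut

/-- The binary digit `δ_j(x)` of a `2`-adic integer `x = ∑ j, δ_j(x) 2 ^ j`: the bit number `j` of
the residue of `x` modulo `2 ^ (j + 1)`. -/
noncomputable def digit (x : ℤ_[2]) (j : ℕ) : Bool :=
  (PadicInt.toZModPow (p := 2) (j + 1) x).val.testBit j

/-- A univariate T-function: there are Boolean (coordinate) functions `ψ_j` in `j + 1` variables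
such that, for every `x` and `j`, the digit number `j` of `f x` is `ψ_j` of the digits
`δ_0(x), …, δ_j(x)`. -/
def IsTFunction (f : ℤ_[2] → ℤ_[2]) : Prop :=
  ∃ ψ : (j : ℕ) → (Fin (j + 1) → Bool) → Bool,
    ∀ (x : ℤ_[2]) (j : ℕ), digit (f x) j = ψ j (fun i => digit x i)

open Classical in
/-- The function `χ(m, x)`: the indicator function of the ball `|x - m|₂ ≤ 2 ^ (-n)`, where `n = 1`
if `m = 0`, and `2 ^ (n - 1) ≤ m ≤ 2 ^ n - 1` otherwise, that is, `n = ⌊log₂ m⌋ + 1`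
(`Nat.log 2 0 = 0`). -/
noncomputable def chi (m : ℕ) (x : ℤ_[2]) : ℤ_[2] :=
  if ‖x - (m : ℤ_[2])‖ ≤ (2 : ℝ) ^ (-((Nat.log 2 m + 1 : ℕ) : ℤ)) then 1 else 0

/-- `f` is represented by the van der Put series with coefficients `B`:
`f x = ∑_{m = 0}^∞ B_m χ(m, x)` for all `x`. -/
def IsVanDerPutSeries (f : ℤ_[2] → ℤ_[2]) (B : ℕ → ℤ_[2]) : Prop :=
  ∀ x : ℤ_[2], Filter.Tendsto (fun N : ℕ => ∑ m ∈ Finset.range N, B m * chi m x)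
    Filter.atTop (nhds (f x))

/-- The normalized Haar measure on the additive group of `2`-adic integers (total mass `1`). -/
noncomputable def haar [MeasurableSpace ℤ_[2]] [BorelSpace ℤ_[2]] :
    MeasureTheory.Measure ℤ_[2] :=
  MeasureTheory.Measure.addHaarMeasure (⊤ : TopologicalSpace.PositiveCompacts ℤ_[2])

end VanDerPut

/-!
A T-function is a compatible map: it preserves congruences modulo every `2 ^ k`, so it induces a map
on `ZMod (2 ^ k)` for every `k` (`residueMap`). The proof has three parts.

*Ergodicity means that every induced map is a single cycle* (`IsCompatible.ergodic_iff`). If `f` is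
ergodic, every residue ball has positive measure, so the induced map is onto and has no nontrivial
invariant set. Conversely, a single cycle permutes the balls of a given radius cyclically. Hence the
push-forward of the Haar measure, and the restriction of the Haar measure `μ` to an invariant set
`S`, give equal mass to balls of equal radius, and such a measure is a multiple of `μ`
(`eq_smul_haar`). For the restriction this reads `μ (A ∩ S) = μ S * μ A`; taking `A = Sᶜ` shows that
`μ S = 0` or `μ Sᶜ = 0`.

*Lifting a cycle from level `k` to level `k + 1`* (`IsTransitiveMod.succ_iff`). The map has to be
bijective modulo `2 ^ (k + 1)`, which means `f (x + 2 ^ k) ≡ f x + 2 ^ k` (`FlipsDigit`), and the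
orbit of `0` must not close up after `2 ^ k` steps. The displacement `f x - x` modulo `2 ^ (k + 1)`
then depends only on `x` modulo `2 ^ k`, and the orbit visits each residue modulo `2 ^ k` once, so
`f^[2 ^ k] 0 ≡ ∑ m < 2 ^ k, (f m - m)` modulo `2 ^ (k + 1)`
(`IsTransitiveMod.dvd_iterate_sub_displacementSum`). The cycle lifts if and only if this
`displacementSum` is `2 ^ k` modulo `2 ^ (k + 1)`.

*Translation to coefficients*. For `2 ^ k ≤ m < 2 ^ (k + 1)` with `k ≥ 1` one has
`B m = f m - f (m - 2 ^ k)`, so `FlipsDigit f k` says `B m ≡ 2 ^ k` modulo `2 ^ (k + 1)`, and the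
displacement sums satisfy `D (k + 1) = 2 * D k + ∑ m, (B m - 2 ^ k)`
(`IsVanDerPutSeries.displacementSum_succ`). So the fourth condition at level `k` passes from the
condition on `D k` to that on `D (k + 1)`, and the first two conditions are those on `D 0` and
`D 1`. The fourth condition also supplies the congruence for the index `2 ^ (k + 1) - 1`, which the
third one leaves out.
-/

open MeasureTheory Function
open PadicInt (toZModPow)

namespace VanDerPut

/-! ### Congruences modulo powers of two -/

theorem toZModPow_eq_iff_dvd_sub {k : ℕ} {x y : ℤ_[2]} :
    toZModPow k x = toZModPow k y ↔ (2 : ℤ_[2]) ^ k ∣ x - y := by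
  rw [← sub_eq_zero, ← map_sub, ← RingHom.mem_ker, PadicInt.ker_toZModPow,
    Ideal.mem_span_singleton]
  rfl

theorem toZModPow_eq_zero_iff_dvd {k : ℕ} {x : ℤ_[2]} :
    toZModPow k x = 0 ↔ (2 : ℤ_[2]) ^ k ∣ x := by
  simpa using toZModPow_eq_iff_dvd_sub (k := k) (x := x) (y := 0)

theorem norm_le_two_zpow_neg_iff_dvd {k : ℕ} {x : ℤ_[2]} :
    ‖x‖ ≤ (2 : ℝ) ^ (-(k : ℤ)) ↔ (2 : ℤ_[2]) ^ k ∣ x := by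
  have h := PadicInt.norm_le_pow_iff_mem_span_pow (p := 2) x k
  rw [Ideal.mem_span_singleton] at h
  exact_mod_cast h

theorem dvd_sub_val_toZModPow (k : ℕ) (x : ℤ_[2]) :
    (2 : ℤ_[2]) ^ k ∣ x - ((toZModPow k x).val : ℤ_[2]) := by
  rw [← toZModPow_eq_iff_dvd_sub]
  simp

theorem val_toZModPow_natCast (k m : ℕ) :
    (toZModPow k (m : ℤ_[2])).val = m % 2 ^ k := by
  rw [map_natCast, ZMod.val_natCast]

/-- A `2`-adic integer is odd if and only if it is congruent to `1` modulo `2`. -/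
theorem not_two_dvd_iff {u : ℤ_[2]} : ¬ (2 : ℤ_[2]) ∣ u ↔ (2 : ℤ_[2]) ∣ u - 1 := by
  have h0 := toZModPow_eq_iff_dvd_sub (k := 1) (x := u) (y := 0)
  have h1 := toZModPow_eq_iff_dvd_sub (k := 1) (x := u) (y := 1)
  simp only [map_zero, pow_one, sub_zero] at h0
  simp only [map_one, pow_one] at h1
  rw [← h0, ← h1]
  generalize toZModPow 1 u = a
  change ZMod 2 at a
  revert a
  decide

theorem dvd_sub_two_pow_iff {k : ℕ} {x : ℤ_[2]} :
    (2 : ℤ_[2]) ^ (k + 1) ∣ x - 2 ^ k ↔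
      (2 : ℤ_[2]) ^ k ∣ x ∧ ¬ (2 : ℤ_[2]) ^ (k + 1) ∣ x := by
  have key (u : ℤ_[2]) : (2 : ℤ_[2]) ^ (k + 1) ∣ 2 ^ k * u - 2 ^ k ↔
      ¬ (2 : ℤ_[2]) ^ (k + 1) ∣ 2 ^ k * u := by
    have h2 : (2 : ℤ_[2]) ^ k ≠ 0 := pow_ne_zero _ two_ne_zero
    rw [show (2 : ℤ_[2]) ^ k * u - 2 ^ k = 2 ^ k * (u - 1) by ring, pow_succ,
      mul_dvd_mul_iff_left h2, mul_dvd_mul_iff_left h2, not_two_dvd_iff]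
  constructor
  · intro h
    have hx : (2 : ℤ_[2]) ^ k ∣ x :=
      (dvd_sub_left (dvd_refl _)).1 ((pow_dvd_pow _ k.le_succ).trans h)
    obtain ⟨u, rfl⟩ := hx
    exact ⟨dvd_mul_right _ _, (key u).1 h⟩
  · rintro ⟨⟨u, rfl⟩, h⟩
    exact (key u).2 h

theorem norm_eq_two_zpow_neg_iff {k : ℕ} {x : ℤ_[2]} :
    ‖x‖ = (2 : ℝ) ^ (-(k : ℤ)) ↔ (2 : ℤ_[2]) ^ (k + 1) ∣ x - 2 ^ k := by
  rw [dvd_sub_two_pow_iff, ← norm_le_two_zpow_neg_iff_dvd, ← norm_le_two_zpow_neg_iff_dvd]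
  have h := PadicInt.norm_le_pow_iff_norm_lt_pow_add_one x (-((k + 1 : ℕ) : ℤ))
  rw [show -((k + 1 : ℕ) : ℤ) + 1 = -(k : ℤ) by push_cast; ring] at h
  have h' : ‖x‖ ≤ (2 : ℝ) ^ (-((k + 1 : ℕ) : ℤ)) ↔ ‖x‖ < (2 : ℝ) ^ (-(k : ℤ)) := by
    exact_mod_cast h
  rw [h', not_lt, le_antisymm_iff]

/-! ### Compatible maps and their reductions -/

/-- A map `f` on `ℤ_[2]` is compatible if it preserves every congruence modulo a power of `2`;
equivalently, it is `1`-Lipschitz for the `2`-adic absolute value. -/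
def IsCompatible (f : ℤ_[2] → ℤ_[2]) : Prop :=
  ∀ (k : ℕ) (x y : ℤ_[2]), (2 : ℤ_[2]) ^ k ∣ x - y → (2 : ℤ_[2]) ^ k ∣ f x - f y

theorem testBit_val_toZModPow (k j : ℕ) (x : ℤ_[2]) :
    (toZModPow k x).val.testBit j = (decide (j < k) && digit x j) := by
  by_cases hj : j < k
  · have h : toZModPow (j + 1) x = toZModPow (j + 1) ((toZModPow k x).val : ℤ_[2]) :=
      toZModPow_eq_iff_dvd_sub.2 ((pow_dvd_pow _ hj).trans (dvd_sub_val_toZModPow k x))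
    rw [digit, h, val_toZModPow_natCast, Nat.testBit_mod_two_pow]
    simp [hj]
  · rw [Nat.testBit_lt_two_pow
      ((ZMod.val_lt _).trans_le (Nat.pow_le_pow_right two_pos (not_lt.1 hj)))]
    simp [hj]

theorem dvd_sub_iff_digit_eq {k : ℕ} {x y : ℤ_[2]} :
    (2 : ℤ_[2]) ^ k ∣ x - y ↔ ∀ j < k, digit x j = digit y j := by
  rw [← toZModPow_eq_iff_dvd_sub]
  constructor
  · intro h j hj
    have := congrArg (fun a => (ZMod.val a).testBit j) h
    simpa [testBit_val_toZModPow, hj] using this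
  · intro h
    apply ZMod.val_injective
    apply Nat.eq_of_testBit_eq
    intro j
    rw [testBit_val_toZModPow, testBit_val_toZModPow]
    by_cases hj : j < k
    · rw [h j hj]
    · simp [hj]

theorem IsTFunction.isCompatible {f : ℤ_[2] → ℤ_[2]} (hf : IsTFunction f) : IsCompatible f := by
  obtain ⟨ψ, hψ⟩ := hf
  intro k x y hxy
  rw [dvd_sub_iff_digit_eq] at hxy ⊢
  intro j hj
  rw [hψ, hψ]
  congr 1
  funext i
  exact hxy i (by omega)

/-- The map induced by `f` on the residues modulo `2 ^ k`, computed on the representatives in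
`[0, 2 ^ k)`. -/
noncomputable def residueMap (f : ℤ_[2] → ℤ_[2]) (k : ℕ) (a : ZMod (2 ^ k)) : ZMod (2 ^ k) :=
  toZModPow k (f (a.val : ℤ_[2]))

variable {f : ℤ_[2] → ℤ_[2]} {k : ℕ}

theorem IsCompatible.semiconj (hf : IsCompatible f) (k : ℕ) :
    Semiconj (toZModPow (p := 2) k) f (residueMap f k) := fun x =>
  toZModPow_eq_iff_dvd_sub.2 (hf k _ _ (dvd_sub_val_toZModPow k x))

theorem IsCompatible.toZModPow_iterate (hf : IsCompatible f) (k i : ℕ) (x : ℤ_[2]) :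
    toZModPow k (f^[i] x) = (residueMap f k)^[i] (toZModPow k x) :=
  (hf.semiconj k).iterate_right i x

theorem IsCompatible.toZModPow_iterate_zero (hf : IsCompatible f) (k i : ℕ) :
    toZModPow k (f^[i] 0) = (residueMap f k)^[i] 0 := by
  rw [hf.toZModPow_iterate, map_zero]

theorem toZModPow_surjective (k : ℕ) : Surjective (toZModPow (p := 2) k) := fun a =>
  ⟨(a.val : ℤ_[2]), by simp⟩

/-- The residue map modulo `2 ^ k` is a single cycle: the orbit of `0` has length `2 ^ k`. -/
def IsTransitiveMod (f : ℤ_[2] → ℤ_[2]) (k : ℕ) : Prop :=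
  minimalPeriod (residueMap f k) 0 = 2 ^ k

theorem IsTransitiveMod.exists_iterate_eq {k : ℕ} (h : IsTransitiveMod f k) (a : ZMod (2 ^ k)) :
    ∃ i < 2 ^ k, (residueMap f k)^[i] 0 = a := by
  have hinj : Injective fun i : Fin (2 ^ k) => (residueMap f k)^[(i : ℕ)] 0 := by
    intro i j hij
    have := iterate_injOn_Iio_minimalPeriod (f := residueMap f k) (x := 0)
      (h.symm ▸ i.2 : (i : ℕ) < _) (h.symm ▸ j.2 : (j : ℕ) < _) hij
    exact Fin.ext this
  have hbij := (Fintype.bijective_iff_injective_and_card _).2 ⟨hinj, by simp [ZMod.card]⟩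
  obtain ⟨i, hi⟩ := hbij.2 a
  exact ⟨i, i.2, hi⟩

theorem IsTransitiveMod.injective {k : ℕ} (h : IsTransitiveMod f k) :
    Injective (residueMap f k) := by
  rw [Finite.injective_iff_surjective]
  intro a
  obtain ⟨i, -, rfl⟩ := h.exists_iterate_eq a
  -- Adding the period `2 ^ k` makes the number of steps positive.
  have hp : (residueMap f k)^[i + 2 ^ k] 0 = (residueMap f k)^[i] 0 := by
    have := iterate_add_minimalPeriod_eq (f := residueMap f k) (x := 0) (n := i)
    rwa [show minimalPeriod (residueMap f k) 0 = 2 ^ k from h] at this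
  obtain ⟨n, hn⟩ : ∃ n, i + 2 ^ k = n + 1 :=
    ⟨i + 2 ^ k - 1, by have := Nat.two_pow_pos k; omega⟩
  rw [hn, iterate_succ_apply'] at hp
  exact ⟨_, hp⟩

/-- On a finite set, an injective map whose invariant sets are trivial is a single cycle. -/
theorem minimalPeriod_eq_card_of_forall_invariant {α : Type*} [Fintype α] {g : α → α}
    (hg : Injective g) (a : α)
    (h : ∀ A : Set α, a ∈ A → g ⁻¹' A = A → A = Set.univ) :
    minimalPeriod g a = Fintype.card α := by
  have ha : a ∈ periodicPts g := hg.mem_periodicPts a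
  have hpos : 0 < minimalPeriod g a := minimalPeriod_pos_of_mem_periodicPts ha
  let A : Set α := Set.range fun i : Fin (minimalPeriod g a) => g^[(i : ℕ)] a
  have hmem (n : ℕ) : g^[n] a ∈ A :=
    ⟨⟨n % minimalPeriod g a, Nat.mod_lt _ hpos⟩, iterate_mod_minimalPeriod_eq⟩
  have hA : A = Set.univ := by
    refine h A (hmem 0) ?_
    ext x
    constructor
    · rintro ⟨i, hi⟩
      have hi' : g^[(i : ℕ) + minimalPeriod g a] a = g x := by
        rw [iterate_add_minimalPeriod_eq]
        exact hi
      obtain ⟨n, hn⟩ : ∃ n, (i : ℕ) + minimalPeriod g a = n + 1 :=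
        ⟨i + minimalPeriod g a - 1, by omega⟩
      rw [hn, iterate_succ_apply'] at hi'
      exact hg hi' ▸ hmem n
    · rintro ⟨i, rfl⟩
      change g (g^[(i : ℕ)] a) ∈ A
      rw [← iterate_succ_apply' g]
      exact hmem _
  have hinj : Injective fun i : Fin (minimalPeriod g a) => g^[(i : ℕ)] a := fun i j hij =>
    Fin.ext (iterate_injOn_Iio_minimalPeriod i.2 j.2 hij)
  simpa using Fintype.card_of_bijective ⟨hinj, Set.range_eq_univ.1 hA⟩

/-! ### Lifting a single cycle from one level to the next -/

/-- Changing digit number `k` of the argument changes digit number `k` of the value. For a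
compatible map that is a bijection modulo `2 ^ k`, this says that it is a bijection modulo
`2 ^ (k + 1)`. -/
def FlipsDigit (f : ℤ_[2] → ℤ_[2]) (k : ℕ) : Prop :=
  ∀ x : ℤ_[2], (2 : ℤ_[2]) ^ (k + 1) ∣ f (x + 2 ^ k) - f x - 2 ^ k

/-- The sum of the displacements `f m - m` over the representatives of the residues
modulo `2 ^ k`. -/
noncomputable def displacementSum (f : ℤ_[2] → ℤ_[2]) (k : ℕ) : ℤ_[2] :=
  ∑ m ∈ Finset.range (2 ^ k), (f m - m)

theorem IsCompatible.iterate (hf : IsCompatible f) (n : ℕ) : IsCompatible f^[n] := by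
  induction n with
  | zero => exact fun _ _ _ h => h
  | succ n ih =>
    rw [iterate_succ']
    exact fun l x y h => hf l _ _ (ih l x y h)

theorem FlipsDigit.iterate (h : FlipsDigit f k) (hf : IsCompatible f) (i : ℕ) (x : ℤ_[2]) :
    (2 : ℤ_[2]) ^ (k + 1) ∣ f^[i] (x + 2 ^ k) - f^[i] x - 2 ^ k := by
  induction i with
  | zero => simp
  | succ i ih =>
    rw [iterate_succ_apply', iterate_succ_apply']
    have h1 := hf (k + 1) (f^[i] (x + 2 ^ k)) (f^[i] x + 2 ^ k) (by rwa [← sub_sub])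
    have h2 := dvd_add h1 (h (f^[i] x))
    convert h2 using 1
    ring

/-- Two numbers congruent modulo `2 ^ k` are congruent modulo `2 ^ (k + 1)`, possibly after adding
`2 ^ k` to one of them. -/
theorem dvd_sub_or_dvd_sub_add {k : ℕ} {x y : ℤ_[2]} (h : (2 : ℤ_[2]) ^ k ∣ x - y) :
    (2 : ℤ_[2]) ^ (k + 1) ∣ x - y ∨ (2 : ℤ_[2]) ^ (k + 1) ∣ x - (y + 2 ^ k) := by
  by_cases h' : (2 : ℤ_[2]) ^ (k + 1) ∣ x - y
  · exact Or.inl h'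
  · right
    rw [← sub_sub]
    exact dvd_sub_two_pow_iff.2 ⟨h, h'⟩

/-- The displacement `f x - x` modulo `2 ^ (k + 1)` depends on `x` modulo `2 ^ k` only. -/
theorem FlipsDigit.dvd_displacement_sub (h : FlipsDigit f k) (hf : IsCompatible f) {x y : ℤ_[2]}
    (hxy : (2 : ℤ_[2]) ^ k ∣ x - y) : (2 : ℤ_[2]) ^ (k + 1) ∣ (f x - x) - (f y - y) := by
  rcases dvd_sub_or_dvd_sub_add hxy with h' | h'
  · convert dvd_sub (hf _ _ _ h') h' using 1
    ring
  · convert dvd_sub (dvd_add (hf _ _ _ h') (h y)) h' using 1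
    ring

/-- It suffices to check `FlipsDigit` on the representatives of the residues modulo `2 ^ k`. -/
theorem IsCompatible.flipsDigit_iff (hf : IsCompatible f) :
    FlipsDigit f k ↔ ∀ r < 2 ^ k,
      (2 : ℤ_[2]) ^ (k + 1) ∣ f ((r + 2 ^ k : ℕ) : ℤ_[2]) - f (r : ℤ_[2]) - 2 ^ k := by
  constructor
  · intro h r _
    convert h (r : ℤ_[2]) using 5
    push_cast
    rfl
  · intro h x
    have hr := h _ (ZMod.val_lt (toZModPow k x))
    have hx := dvd_sub_val_toZModPow k x
    generalize (toZModPow k x).val = r at hr hx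
    push_cast at hr
    rcases dvd_sub_or_dvd_sub_add hx with h' | h'
    · have h1 := hf (k + 1) (x + 2 ^ k) (r + 2 ^ k) (by convert h' using 1; ring)
      convert dvd_sub (dvd_add h1 hr) (hf _ _ _ h') using 1
      ring
    · have h1 := hf (k + 1) (x + 2 ^ k) r (by
        convert dvd_add h' (dvd_refl ((2 : ℤ_[2]) ^ (k + 1))) using 1
        ring)
      have h2 := dvd_sub (dvd_sub (dvd_sub h1 hr) (hf _ _ _ h')) (dvd_refl ((2 : ℤ_[2]) ^ (k + 1)))
      convert h2 using 1
      ring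

theorem IsTransitiveMod.sum_orbit {M : Type*} [AddCommMonoid M] (h : IsTransitiveMod f k)
    (g : ℕ → M) :
    ∑ i ∈ Finset.range (2 ^ k), g ((residueMap f k)^[i] 0).val =
      ∑ m ∈ Finset.range (2 ^ k), g m := by
  refine Finset.sum_nbij (fun i => ((residueMap f k)^[i] 0).val) ?_ ?_ ?_ fun _ _ => rfl
  · intro i _
    exact Finset.mem_range.2 (ZMod.val_lt _)
  · intro i hi j hj hij
    rw [Finset.mem_coe, Finset.mem_range] at hi hj
    exact iterate_injOn_Iio_minimalPeriod (h.symm ▸ hi : i < _) (h.symm ▸ hj : j < _)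
      (ZMod.val_injective _ hij)
  · intro m hm
    obtain ⟨i, hi, him⟩ := h.exists_iterate_eq (m : ZMod (2 ^ k))
    refine ⟨i, by simpa using hi, ?_⟩
    simp only [him, ZMod.val_natCast]
    exact Nat.mod_eq_of_lt (by simpa using hm)

/-- After one turn of the cycle modulo `2 ^ k`, the orbit of `0` returns to the sum of all
displacements. -/
theorem IsTransitiveMod.dvd_iterate_sub_displacementSum (h : IsTransitiveMod f k)
    (hf : IsCompatible f) (hd : FlipsDigit f k) :
    (2 : ℤ_[2]) ^ (k + 1) ∣ f^[2 ^ k] 0 - displacementSum f k := by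
  have h1 : f^[2 ^ k] 0 = ∑ i ∈ Finset.range (2 ^ k), (f (f^[i] 0) - f^[i] 0) := by
    have := Finset.sum_range_sub (fun i => f^[i] (0 : ℤ_[2])) (2 ^ k)
    simpa [iterate_succ_apply'] using this.symm
  have h2 := h.sum_orbit (fun m : ℕ => f (m : ℤ_[2]) - m)
  rw [displacementSum, h1, ← h2, ← Finset.sum_sub_distrib]
  refine Finset.dvd_sum fun i _ => hd.dvd_displacement_sub hf ?_
  rw [← hf.toZModPow_iterate_zero]
  exact dvd_sub_val_toZModPow k _

theorem isPeriodicPt_residueMap_iff (hf : IsCompatible f) (k n : ℕ) :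
    IsPeriodicPt (residueMap f k) n 0 ↔ (2 : ℤ_[2]) ^ k ∣ f^[n] 0 := by
  rw [← toZModPow_eq_zero_iff_dvd, hf.toZModPow_iterate_zero]
  rfl

theorem IsTransitiveMod.dvd_iterate_iff (h : IsTransitiveMod f k) (hf : IsCompatible f) (n : ℕ) :
    (2 : ℤ_[2]) ^ k ∣ f^[n] 0 ↔ 2 ^ k ∣ n := by
  rw [← isPeriodicPt_residueMap_iff hf, isPeriodicPt_iff_minimalPeriod_dvd]
  exact iff_of_eq (congrArg (· ∣ n) h)

theorem IsTransitiveMod.flipsDigit (h : IsTransitiveMod f (k + 1)) (hf : IsCompatible f) :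
    FlipsDigit f k := by
  intro x
  refine dvd_sub_two_pow_iff.2 ⟨hf _ _ _ (by simp), fun hdvd => ?_⟩
  rw [← toZModPow_eq_iff_dvd_sub, hf.semiconj, hf.semiconj] at hdvd
  have h1 := toZModPow_eq_iff_dvd_sub.1 (h.injective hdvd)
  rw [add_sub_cancel_left] at h1
  exact (dvd_sub_two_pow_iff.1 (by simp : (2 : ℤ_[2]) ^ (k + 1) ∣ 2 ^ k - 2 ^ k)).2 h1

theorem IsTransitiveMod.succ_iff (h : IsTransitiveMod f k) (hf : IsCompatible f)
    (hd : FlipsDigit f k) :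
    IsTransitiveMod f (k + 1) ↔ (2 : ℤ_[2]) ^ (k + 1) ∣ displacementSum f k - 2 ^ k := by
  have hsum := h.dvd_iterate_sub_displacementSum hf hd
  have hiff : (2 : ℤ_[2]) ^ (k + 1) ∣ displacementSum f k - 2 ^ k ↔
      (2 : ℤ_[2]) ^ (k + 1) ∣ f^[2 ^ k] 0 - 2 ^ k := by
    rw [← dvd_add_right hsum]
    ring_nf
  rw [hiff]
  constructor
  · intro h'
    rw [dvd_sub_two_pow_iff, h.dvd_iterate_iff hf, h'.dvd_iterate_iff hf]
    exact ⟨dvd_rfl, fun hdvd => absurd (Nat.le_of_dvd (by positivity) hdvd)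
      (not_le.2 (Nat.pow_lt_pow_right one_lt_two k.lt_succ_self))⟩
  · intro h'
    refine minimalPeriod_eq_prime_pow (p := 2) ?_ ?_
    · rw [isPeriodicPt_residueMap_iff hf]
      exact (dvd_sub_two_pow_iff.1 h').2
    · -- Two turns of the cycle modulo `2 ^ k` move `0` by `2 ^ k + 2 ^ k`.
      rw [isPeriodicPt_residueMap_iff hf, show 2 ^ (k + 1) = 2 ^ k + 2 ^ k by ring,
        iterate_add_apply]
      have h2 : (2 : ℤ_[2]) ^ (k + 1) ∣ f^[2 ^ k] (f^[2 ^ k] 0) - f^[2 ^ k] (0 + 2 ^ k) :=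
        hf.iterate (2 ^ k) (k + 1) _ _ (by rwa [zero_add])
      have h3 := dvd_add (dvd_add (dvd_add h2 (hd.iterate hf (2 ^ k) 0)) h')
        (dvd_refl ((2 : ℤ_[2]) ^ (k + 1)))
      convert h3 using 1
      ring

theorem IsCompatible.forall_isTransitiveMod_iff (hf : IsCompatible f) :
    (∀ k, IsTransitiveMod f k) ↔
      ∀ k, FlipsDigit f k ∧ (2 : ℤ_[2]) ^ (k + 1) ∣ displacementSum f k - 2 ^ k := by
  constructor
  · intro h k
    have hd := (h (k + 1)).flipsDigit hf
    exact ⟨hd, ((h k).succ_iff hf hd).1 (h (k + 1))⟩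
  · intro h k
    induction k with
    | zero =>
      have : Subsingleton (ZMod (2 ^ 0)) := inferInstanceAs (Subsingleton (ZMod 1))
      exact minimalPeriod_eq_one_of_subsingleton
    | succ k ih => exact (ih.succ_iff hf (h k).1).2 (h k).2

/-! ### The van der Put coefficients -/

variable {B : ℕ → ℤ_[2]}

theorem chi_natCast (m n : ℕ) :
    chi m (n : ℤ_[2]) = if n ≡ m [MOD 2 ^ (Nat.log 2 m + 1)] then 1 else 0 := by
  rw [chi]
  congr 1
  rw [norm_le_two_zpow_neg_iff_dvd, ← toZModPow_eq_iff_dvd_sub, map_natCast, map_natCast,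
    ZMod.natCast_eq_natCast_iff]

theorem chi_natCast_of_lt {m n : ℕ} (h : n < 2 ^ (Nat.log 2 m + 1)) :
    chi m (n : ℤ_[2]) = if n = m then 1 else 0 := by
  rw [chi_natCast]
  congr 1
  refine propext ⟨fun h' => h'.eq_of_lt_of_lt h (Nat.lt_pow_succ_log_self one_lt_two m), ?_⟩
  rintro rfl
  rfl

/-- At a natural number the van der Put series is a finite sum. -/
theorem IsVanDerPutSeries.eq_sum (hB : IsVanDerPutSeries f B) {n N : ℕ} (h : n < N) :
    f (n : ℤ_[2]) = ∑ m ∈ Finset.range N, B m * chi m (n : ℤ_[2]) := by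
  refine tendsto_nhds_unique (hB n) (tendsto_atTop_of_eventually_const (i₀ := N) fun M hM => ?_)
  symm
  refine Finset.sum_subset (Finset.range_mono hM) fun m _ hm => ?_
  have hNm : N ≤ m := by simpa using hm
  rw [chi_natCast_of_lt ((h.trans_le hNm).trans (Nat.lt_pow_succ_log_self one_lt_two m)),
    if_neg (by omega), mul_zero]

theorem IsVanDerPutSeries.apply_zero (hB : IsVanDerPutSeries f B) : f 0 = B 0 := by
  have h := hB.eq_sum (n := 0) (N := 1) (by norm_num)
  rw [Finset.sum_range_one, chi_natCast_of_lt (by positivity)] at h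
  simpa using h

theorem IsVanDerPutSeries.apply_one (hB : IsVanDerPutSeries f B) : f 1 = B 1 := by
  have h := hB.eq_sum (n := 1) (N := 2) (by norm_num)
  rw [Finset.sum_range_succ, Finset.sum_range_one, chi_natCast_of_lt (by simp),
    chi_natCast_of_lt (by simp)] at h
  simpa using h

theorem IsVanDerPutSeries.coeff_eq (hB : IsVanDerPutSeries f B) {k r : ℕ} (hk : 1 ≤ k)
    (hr : r < 2 ^ k) :
    B (2 ^ k + r) = f ((r + 2 ^ k : ℕ) : ℤ_[2]) - f (r : ℤ_[2]) := by
  rw [hB.eq_sum hr, hB.eq_sum (show r + 2 ^ k < 2 ^ k + 2 ^ k by omega),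
    Finset.sum_range_add]
  have h1 : ∑ m ∈ Finset.range (2 ^ k), B m * chi m ((r + 2 ^ k : ℕ) : ℤ_[2]) =
      ∑ m ∈ Finset.range (2 ^ k), B m * chi m (r : ℤ_[2]) := by
    refine Finset.sum_congr rfl fun m hm => ?_
    have hlog : Nat.log 2 m + 1 ≤ k := Nat.log_lt_of_lt_pow' (by omega) (by simpa using hm)
    have hmod : r + 2 ^ k ≡ r [MOD 2 ^ (Nat.log 2 m + 1)] := by
      simpa using (Nat.ModEq.refl r).add ((Nat.modEq_zero_iff_dvd).2 (pow_dvd_pow 2 hlog))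
    have hiff : r + 2 ^ k ≡ m [MOD 2 ^ (Nat.log 2 m + 1)] ↔ r ≡ m [MOD 2 ^ (Nat.log 2 m + 1)] :=
      ⟨hmod.symm.trans, hmod.trans⟩
    simp only [chi_natCast, hiff]
  have h2 (m : ℕ) (hm : m ∈ Finset.range (2 ^ k)) :
      B (2 ^ k + m) * chi (2 ^ k + m) ((r + 2 ^ k : ℕ) : ℤ_[2]) =
        if m = r then B (2 ^ k + m) else 0 := by
    have hlog : k ≤ Nat.log 2 (2 ^ k + m) := Nat.le_log_of_pow_le one_lt_two (by omega)
    have := Nat.pow_le_pow_right two_pos (Nat.succ_le_succ hlog)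
    rw [chi_natCast_of_lt (lt_of_lt_of_le (by rw [Nat.succ_eq_add_one, pow_succ]; omega) this)]
    simp only [show (r + 2 ^ k = 2 ^ k + m) ↔ m = r by omega, mul_ite, mul_one, mul_zero]
  rw [h1, Finset.sum_congr rfl h2, Finset.sum_ite_eq', if_pos (by simpa using hr)]
  ring

theorem sum_Icc_eq_sum_range {M : Type*} [AddCommMonoid M] (g : ℕ → M) (k : ℕ) :
    ∑ m ∈ Finset.Icc (2 ^ k) (2 ^ (k + 1) - 1), g m = ∑ r ∈ Finset.range (2 ^ k), g (2 ^ k + r) := by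
  have h : Finset.Icc (2 ^ k) (2 ^ (k + 1) - 1) = Finset.Ico (2 ^ k) (2 ^ (k + 1)) := by
    ext m
    have := Nat.two_pow_pos (k + 1)
    simp only [Finset.mem_Icc, Finset.mem_Ico]
    omega
  rw [h, Finset.sum_Ico_eq_sum_range, pow_succ, show 2 ^ k * 2 - 2 ^ k = 2 ^ k by omega]

theorem IsVanDerPutSeries.displacementSum_succ (hB : IsVanDerPutSeries f B) {k : ℕ} (hk : 1 ≤ k) :
    displacementSum f (k + 1) = 2 * displacementSum f k +
      ∑ m ∈ Finset.Icc (2 ^ k) (2 ^ (k + 1) - 1), (B m - 2 ^ k) := by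
  rw [sum_Icc_eq_sum_range (fun m => B m - 2 ^ k), displacementSum,
    pow_succ, mul_two, Finset.sum_range_add, displacementSum, two_mul]
  simp only [← Finset.sum_add_distrib]
  refine Finset.sum_congr rfl fun r hr => ?_
  rw [hB.coeff_eq hk (by simpa using hr), add_comm (2 ^ k) r]
  push_cast
  ring

theorem IsVanDerPutSeries.flipsDigit_iff (hB : IsVanDerPutSeries f B) (hf : IsCompatible f)
    {k : ℕ} (hk : 1 ≤ k) :
    FlipsDigit f k ↔ ∀ r < 2 ^ k, (2 : ℤ_[2]) ^ (k + 1) ∣ B (2 ^ k + r) - 2 ^ k := by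
  rw [hf.flipsDigit_iff]
  exact forall₂_congr fun r hr => by rw [hB.coeff_eq hk hr]

/-- If the terms of level `k` sum to `0` modulo `2 ^ (k + 1)`, the congruence for the last of them
follows from the others. -/
theorem dvd_forall_iff_of_dvd_sum {M : Type*} [CommRing M] {d : M} {g : ℕ → M} {a b : ℕ}
    (hab : a ≤ b) (hsum : d ∣ ∑ m ∈ Finset.Icc a b, g m) :
    (∀ m ∈ Finset.Icc a b, d ∣ g m) ↔ ∀ m ∈ Finset.Ico a b, d ∣ g m := by
  refine ⟨fun h m hm => h m (Finset.Ico_subset_Icc_self hm), fun h m hm => ?_⟩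
  rcases (Finset.mem_Icc.1 hm).2.lt_or_eq with hlt | rfl
  · exact h m (Finset.mem_Ico.2 ⟨(Finset.mem_Icc.1 hm).1, hlt⟩)
  · rw [← Finset.sum_Ico_add_eq_sum_Icc hab] at hsum
    exact (dvd_add_right (Finset.dvd_sum h)).1 hsum

/-! ### Measures on the `2`-adic integers and their values on balls -/

/-- The ball of all `2`-adic integers whose residue modulo `2 ^ k` is `a`. -/
def residueBall (k : ℕ) (a : ZMod (2 ^ k)) : Set ℤ_[2] :=
  toZModPow k ⁻¹' {a}

theorem mem_residueBall {a : ZMod (2 ^ k)} {x : ℤ_[2]} :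
    x ∈ residueBall k a ↔ toZModPow k x = a := Iff.rfl

theorem residueBall_nonempty (k : ℕ) (a : ZMod (2 ^ k)) : (residueBall k a).Nonempty :=
  toZModPow_surjective k a

theorem residueBall_toZModPow (k : ℕ) (x : ℤ_[2]) :
    residueBall k (toZModPow k x) = Metric.closedBall x ((2 : ℝ) ^ (-(k : ℤ))) := by
  ext y
  rw [mem_residueBall, toZModPow_eq_iff_dvd_sub, ← norm_le_two_zpow_neg_iff_dvd,
    Metric.mem_closedBall, dist_eq_norm]

theorem isOpen_residueBall (k : ℕ) (a : ZMod (2 ^ k)) : IsOpen (residueBall k a) := by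
  obtain ⟨x, rfl⟩ := toZModPow_surjective k a
  rw [residueBall_toZModPow]
  exact IsUltrametricDist.isOpen_closedBall x (by positivity)

theorem isTopologicalBasis_residueBall :
    TopologicalSpace.IsTopologicalBasis
      (Set.range fun p : Σ k, ZMod (2 ^ k) => residueBall p.1 p.2) := by
  refine TopologicalSpace.isTopologicalBasis_of_isOpen_of_nhds ?_ fun x u hx hu => ?_
  · rintro _ ⟨p, rfl⟩
    exact isOpen_residueBall _ _
  · obtain ⟨ε, hε, hball⟩ := Metric.isOpen_iff.1 hu x hx
    obtain ⟨k, hk⟩ := PadicInt.exists_pow_neg_lt 2 hε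
    refine ⟨_, ⟨⟨k, toZModPow k x⟩, rfl⟩, rfl, ?_⟩
    dsimp only
    rw [residueBall_toZModPow]
    exact (Metric.closedBall_subset_ball (by exact_mod_cast hk)).trans hball

theorem residueBall_subset {k l : ℕ} (hkl : k ≤ l) {x : ℤ_[2]} :
    residueBall l (toZModPow l x) ⊆ residueBall k (toZModPow k x) := fun y hy => by
  rw [mem_residueBall, toZModPow_eq_iff_dvd_sub] at hy ⊢
  exact (pow_dvd_pow _ hkl).trans hy

theorem isPiSystem_residueBall :
    IsPiSystem (Set.range fun p : Σ k, ZMod (2 ^ k) => residueBall p.1 p.2) := by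
  rintro _ ⟨⟨k, a⟩, rfl⟩ _ ⟨⟨l, b⟩, rfl⟩ ⟨x, hx⟩
  obtain ⟨rfl, rfl⟩ : toZModPow k x = a ∧ toZModPow l x = b := hx
  rcases le_total k l with h | h
  · exact ⟨⟨l, toZModPow l x⟩, (Set.inter_eq_self_of_subset_right (residueBall_subset h)).symm⟩
  · exact ⟨⟨k, toZModPow k x⟩, (Set.inter_eq_self_of_subset_left (residueBall_subset h)).symm⟩

theorem IsCompatible.preimage_preimage (hf : IsCompatible f) (A : Set (ZMod (2 ^ k))) :
    f ⁻¹' (toZModPow k ⁻¹' A) = toZModPow k ⁻¹' (residueMap f k ⁻¹' A) := by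
  rw [← Set.preimage_comp, ← Set.preimage_comp, (hf.semiconj k).comp_eq]

theorem IsTransitiveMod.preimage_residueBall (h : IsTransitiveMod f k) (hf : IsCompatible f)
    (a : ZMod (2 ^ k)) : f ⁻¹' residueBall k (residueMap f k a) = residueBall k a := by
  rw [residueBall, hf.preimage_preimage, ← Set.image_singleton, h.injective.preimage_image]
  rfl

theorem IsCompatible.continuous (hf : IsCompatible f) : Continuous f := by
  refine isTopologicalBasis_residueBall.continuous_iff.2 ?_
  rintro _ ⟨⟨k, a⟩, rfl⟩
  change IsOpen (f ⁻¹' (toZModPow k ⁻¹' {a}))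
  rw [hf.preimage_preimage, ← Set.biUnion_preimage_singleton]
  exact isOpen_biUnion fun b _ => isOpen_residueBall k b

variable [MeasurableSpace ℤ_[2]] [BorelSpace ℤ_[2]]

theorem measurableSet_residueBall (k : ℕ) (a : ZMod (2 ^ k)) : MeasurableSet (residueBall k a) :=
  (isOpen_residueBall k a).measurableSet

instance : haar.IsAddHaarMeasure := by
  unfold haar
  infer_instance

instance : IsProbabilityMeasure haar where
  measure_univ := by
    simpa [haar] using Measure.addHaarMeasure_self
      (K₀ := (⊤ : TopologicalSpace.PositiveCompacts ℤ_[2]))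

theorem haar_residueBall_eq (k : ℕ) (a : ZMod (2 ^ k)) :
    haar (residueBall k a) = haar (residueBall k 0) := by
  obtain ⟨x, rfl⟩ := toZModPow_surjective k a
  rw [← measure_preimage_add haar x (residueBall k (toZModPow k x))]
  congr 1
  ext y
  simp [mem_residueBall]

theorem haar_residueBall_ne_zero (k : ℕ) (a : ZMod (2 ^ k)) : haar (residueBall k a) ≠ 0 :=
  (isOpen_residueBall k a).measure_ne_zero haar (residueBall_nonempty k a)

theorem two_pow_mul_measure_residueBall {ν : Measure ℤ_[2]}
    (h : ∀ a, ν (residueBall k a) = ν (residueBall k 0)) (a : ZMod (2 ^ k)) :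
    2 ^ k * ν (residueBall k a) = ν Set.univ := by
  have := sum_measure_preimage_singleton (μ := ν) (f := toZModPow (p := 2) k) Finset.univ
    fun a _ => measurableSet_residueBall k a
  rw [Finset.coe_univ, Set.preimage_univ] at this
  rw [← this, h a]
  change _ = ∑ b, ν (residueBall k b)
  simp [h, ZMod.card]

/-- A finite measure that gives the same mass to all balls of equal radius is a multiple of the
Haar measure. -/
theorem eq_smul_haar {ν : Measure ℤ_[2]} [IsFiniteMeasure ν]
    (h : ∀ k a, ν (residueBall k a) = ν (residueBall k 0)) : ν = ν Set.univ • haar := by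
  refine ext_of_generate_finite _ ?_ isPiSystem_residueBall ?_ (by simp)
  · rw [← isTopologicalBasis_residueBall.borel_eq_generateFrom]
    exact BorelSpace.measurable_eq
  · rintro _ ⟨⟨k, a⟩, rfl⟩
    have hν := two_pow_mul_measure_residueBall (h k) a
    have hhaar := two_pow_mul_measure_residueBall (haar_residueBall_eq k) a
    rw [measure_univ] at hhaar
    dsimp only
    rw [Measure.smul_apply, smul_eq_mul, ← hν, mul_right_comm, hhaar, one_mul]

/-! ### Ergodicity and single cycles -/

/-- The restriction of the Haar measure to an invariant set `S` gives the same mass to all balls of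
equal radius, because `f` permutes these balls cyclically. -/
theorem haar_residueBall_inter_eq (hf : IsCompatible f) (hpres : MeasurePreserving f haar haar)
    (h : IsTransitiveMod f k) {S : Set ℤ_[2]} (hS : MeasurableSet S) (hSf : f ⁻¹' S = S)
    (a : ZMod (2 ^ k)) : haar (residueBall k a ∩ S) = haar (residueBall k 0 ∩ S) := by
  obtain ⟨i, -, rfl⟩ := h.exists_iterate_eq a
  induction i with
  | zero => rfl
  | succ i ih =>
    rw [iterate_succ_apply', ← ih, ← hpres.measure_preimage
      ((measurableSet_residueBall k _).inter hS).nullMeasurableSet, Set.preimage_inter, hSf,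
      h.preimage_residueBall hf]

theorem ergodic_of_forall_isTransitiveMod (hf : IsCompatible f)
    (h : ∀ k, IsTransitiveMod f k) : Ergodic f haar := by
  have hmeas : Measurable f := hf.continuous.measurable
  have hpres : MeasurePreserving f haar haar := by
    refine ⟨hmeas, ?_⟩
    have hball (k : ℕ) (a : ZMod (2 ^ k)) :
        haar.map f (residueBall k a) = haar (residueBall k 0) := by
      obtain ⟨b, rfl⟩ := Finite.surjective_of_injective (h k).injective a
      rw [Measure.map_apply hmeas (measurableSet_residueBall k _),
        (h k).preimage_residueBall hf, haar_residueBall_eq]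
    have : IsProbabilityMeasure (haar.map f) := Measure.isProbabilityMeasure_map hmeas.aemeasurable
    rw [eq_smul_haar (ν := haar.map f) fun k a => by rw [hball, hball], measure_univ, one_smul]
  refine ⟨hpres, ⟨fun S hS hSf => ?_⟩⟩
  have hν : haar.restrict S = haar S • haar := by
    have := eq_smul_haar (ν := haar.restrict S) fun k a => by
      rw [Measure.restrict_apply (measurableSet_residueBall k a),
        Measure.restrict_apply (measurableSet_residueBall k 0)]
      exact haar_residueBall_inter_eq hf hpres (h k) hS hSf a
    rwa [Measure.restrict_apply_univ] at this
  -- Evaluating at the complement of `S` gives `0 = μ S * μ Sᶜ`.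
  have hzero := congrArg (· Sᶜ) hν
  simp only [Measure.restrict_apply hS.compl, Set.compl_inter_self, measure_empty,
    Measure.smul_apply, smul_eq_mul] at hzero
  rw [Filter.eventuallyConst_set', ae_eq_empty, ae_eq_univ]
  exact mul_eq_zero.1 hzero.symm

theorem isTransitiveMod_of_ergodic (hf : IsCompatible f) (h : Ergodic f haar) (k : ℕ) :
    IsTransitiveMod f k := by
  have hmeasSet (A : Set (ZMod (2 ^ k))) : MeasurableSet (toZModPow (p := 2) k ⁻¹' A) := by
    rw [← Set.biUnion_preimage_singleton]
    exact .biUnion (Set.to_countable A) fun a _ => measurableSet_residueBall k a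
  have hnull (A : Set (ZMod (2 ^ k))) (hA : haar (toZModPow (p := 2) k ⁻¹' A) = 0) (a) :
      a ∉ A := fun ha =>
    haar_residueBall_ne_zero k a
      (measure_mono_null (Set.preimage_mono (Set.singleton_subset_iff.2 ha)) hA)
  have hsurj : Surjective (residueMap f k) := by
    intro a
    by_contra! hne
    refine hnull {a} ?_ a rfl
    rw [← h.toMeasurePreserving.measure_preimage (hmeasSet {a}).nullMeasurableSet,
      hf.preimage_preimage, Set.preimage_singleton_eq_empty.2 (by simpa using hne),
      Set.preimage_empty, measure_empty]
  have hmin := minimalPeriod_eq_card_of_forall_invariant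
    (Finite.injective_iff_surjective.2 hsurj) 0 fun A hA0 hA => by
      have hinv : f ⁻¹' (toZModPow k ⁻¹' A) = toZModPow k ⁻¹' A := by
        rw [hf.preimage_preimage, hA]
      rcases h.toPreErgodic.measure_self_or_compl_eq_zero (hmeasSet A) hinv with h0 | h1
      · exact absurd hA0 (hnull A h0 0)
      · exact Set.eq_univ_of_forall fun a => not_not.1 (hnull Aᶜ h1 a)
  rwa [ZMod.card] at hmin

theorem IsCompatible.ergodic_iff (hf : IsCompatible f) :
    Ergodic f haar ↔ ∀ k, IsTransitiveMod f k :=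
  ⟨isTransitiveMod_of_ergodic hf, ergodic_of_forall_isTransitiveMod hf⟩

end VanDerPut

theorem proposition3p7 [MeasurableSpace ℤ_[2]] [BorelSpace ℤ_[2]]
    (f : ℤ_[2] → ℤ_[2]) (hf : VanDerPut.IsTFunction f)
    (B : ℕ → ℤ_[2]) (hB : VanDerPut.IsVanDerPutSeries f B) :
    Ergodic f VanDerPut.haar ↔
      ((2 : ℤ_[2]) ∣ B 0 - 1) ∧
      ((4 : ℤ_[2]) ∣ B 0 + B 1 - 3) ∧
      (∀ n : ℕ, 2 ≤ n → ∀ m : ℕ, 2 ^ (n - 1) ≤ m → m < 2 ^ n - 1 →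
        ‖B m‖ = (2 : ℝ) ^ (-((n : ℤ) - 1))) ∧
      (∀ n : ℕ, 2 ≤ n →
        ‖∑ m ∈ Finset.Icc (2 ^ (n - 1)) (2 ^ n - 1), (B m - 2 ^ (n - 1))‖ ≤
          (2 : ℝ) ^ (-((n : ℤ) + 1))) := by
  open VanDerPut in
  have hc := hf.isCompatible
  rw [hc.ergodic_iff, hc.forall_isTransitiveMod_iff]
  have hshift (P : ℕ → Prop) : (∀ n, 2 ≤ n → P n) ↔ ∀ k, 1 ≤ k → P (k + 1) :=
    ⟨fun h k hk => h (k + 1) (by omega), fun h n hn => by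
      obtain ⟨k, rfl⟩ : ∃ k, n = k + 1 := ⟨n - 1, by omega⟩
      exact h k (by omega)⟩
  have hexp1 (k : ℕ) : -(((k + 1 : ℕ) : ℤ) - 1) = -(k : ℤ) := by push_cast; ring
  have hexp2 (k : ℕ) : -(((k + 1 : ℕ) : ℤ) + 1) = -((k + 2 : ℕ) : ℤ) := by push_cast; ring
  rw [hshift, hshift]
  simp only [Nat.add_sub_cancel, hexp1, hexp2, norm_eq_two_zpow_neg_iff,
    norm_le_two_zpow_neg_iff_dvd]
  have hD0 : displacementSum f 0 - 2 ^ 0 = B 0 - 1 := by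
    simp [displacementSum, hB.apply_zero]
  have hD1 : displacementSum f 1 - 2 ^ 1 = B 0 + B 1 - 3 := by
    simp [displacementSum, Finset.sum_range_succ, hB.apply_zero, hB.apply_one]
    ring
  -- The induction step: condition 4 at level `k` is the difference between the displacement
  -- conditions at the levels `k + 1` and `k`.
  have hstep (k : ℕ) (hk : 1 ≤ k)
      (h : (2 : ℤ_[2]) ^ (k + 1) ∣ displacementSum f k - 2 ^ k) :
      (2 : ℤ_[2]) ^ (k + 2) ∣ displacementSum f (k + 1) - 2 ^ (k + 1) ↔
        (2 : ℤ_[2]) ^ (k + 2) ∣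
          ∑ m ∈ Finset.Icc (2 ^ k) (2 ^ (k + 1) - 1), (B m - 2 ^ k) := by
    have h2 : (2 : ℤ_[2]) ^ (k + 2) ∣ 2 * (displacementSum f k - 2 ^ k) := by
      rw [pow_succ']
      exact mul_dvd_mul_left 2 h
    rw [hB.displacementSum_succ hk, add_sub_right_comm, pow_succ' 2 k, ← mul_sub,
      dvd_add_right h2]
  have hflip (k : ℕ) (hk : 1 ≤ k) (hsum : (2 : ℤ_[2]) ^ (k + 2) ∣
      ∑ m ∈ Finset.Icc (2 ^ k) (2 ^ (k + 1) - 1), (B m - 2 ^ k)) :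
      FlipsDigit f k ↔ ∀ m, 2 ^ k ≤ m → m < 2 ^ (k + 1) - 1 →
        (2 : ℤ_[2]) ^ (k + 1) ∣ B m - 2 ^ k := by
    have hp : 2 ^ (k + 1) = 2 ^ k + 2 ^ k := by ring
    have hpos := Nat.two_pow_pos k
    have hiff := dvd_forall_iff_of_dvd_sum (by omega)
      ((pow_dvd_pow (2 : ℤ_[2]) (k + 1).le_succ).trans hsum)
    simp only [Finset.mem_Icc, Finset.mem_Ico, and_imp] at hiff
    rw [← hiff, hB.flipsDigit_iff hc hk]
    constructor
    · intro h m hm1 hm2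
      obtain ⟨r, rfl⟩ := Nat.exists_eq_add_of_le hm1
      exact h r (by omega)
    · intro h r hr
      exact h _ (by omega) (by omega)
  constructor
  · intro h
    have h4 (k : ℕ) (hk : 1 ≤ k) := (hstep k hk (h k).2).1 (h (k + 1)).2
    refine ⟨?_, ?_, fun k hk => (hflip k hk (h4 k hk)).1 (h k).1, h4⟩
    · rw [← hD0, ← pow_one (2 : ℤ_[2])]
      exact (h 0).2
    · have := (h 1).2
      rw [hD1] at this
      norm_num at this
      exact this
  · rintro ⟨h1, h2, h3, h4⟩
    have hD (k : ℕ) : (2 : ℤ_[2]) ^ (k + 1) ∣ displacementSum f k - 2 ^ k := by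
      induction k with
      | zero =>
        rw [hD0, zero_add, pow_one]
        exact h1
      | succ k ih =>
        rcases Nat.eq_zero_or_pos k with rfl | hk
        · rw [zero_add, hD1]
          norm_num
          exact h2
        · exact (hstep k hk ih).2 (h4 k hk)
    refine fun k => ⟨?_, hD k⟩
    rcases Nat.eq_zero_or_pos k with rfl | hk
    · -- At level `0` the coefficients are values: `B 0` is odd and `B 0 + B 1` is odd.
      rw [hc.flipsDigit_iff]
      intro r hr
      obtain rfl : r = 0 := by simpa using hr
      have h2' : (2 : ℤ_[2]) ∣ B 0 + B 1 - 3 := Dvd.dvd.trans ⟨2, by norm_num⟩ h2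
      have := dvd_sub (dvd_sub h2' h1) (dvd_sub h1 (dvd_refl 2))
      simp only [Nat.cast_zero, zero_add, pow_zero, pow_one, Nat.cast_one, hB.apply_zero,
        hB.apply_one]
      convert dvd_sub this (dvd_refl 2) using 1
      ring
    · exact (hflip k hk (h4 k hk)).2 (h3 k hk)
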